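/- Let $\mathsf T,\mathsf O,\mathsf I\le \mathrm{SL}_2(\mathbb C)$ be a binary tetrahedral, binary octahedral and binary icosahedral group, with $\mathsf T\le\mathsf O$ where both occur, let $\zeta_m$ denote a primitive $m$-th root of unity, and let $\mu_d=\langle \zeta_d I_2\rangle$. For $w\in\mathsf O\setminus\mathsf T$ set $$\mathsf{OT}_d=\bigcup_{k\text{ even}}\zeta_{2d}^k\mathsf T\ \cup\ \bigcup_{k\text{ odd}}\zeta_{2d}^k w\mathsf T .$$ Let $G\le\mathrm{GL}_2(\mathbb C)$ be one of the following groups, with $e\ge 1$: $\mu_e\mathsf T$ with $6\mid e$; $\mu_e\mathsf O$ with $4\mid e$; $\mu_e\mathsf I$ with $e$ divisible by $4$, $6$ or $10$; $\mathsf{OT}_{2e}$ with $4\nmid e$. Then $Z(G)=\mu_d$ for some $d$; let $G_0\le G$ be the subgroup generated by the complex reflections in $G$. For $g\in \mathrm{GL}_2(\mathbb C)$ put $g^\vee=\begin{pmatrix} g&0\\0&(g^\top)^{-1}\end{pmatrix}\in\mathrm{GL}_4(\mathbb C)$, and for a subgroup $K\le\mathrm{GL}_2(\mathbb C)$ put $K^\vee=\{g^\vee\mid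 g\in K\}$. Let $$s=\begin{pmatrix}0&0&0&1\\0&0&-1&0\\0&-1&0&0\\1&0&0&0\end{pmatrix},\qquad E(G)=\{g^\vee,\,g^\vee s\mid g\in G\},\qquad D_d=\langle \mu_d^\vee,s\rangle .$$ These are finite groups preserving the standard symplectic form $\omega$ on $V=\mathbb C^4$. For a finite group $\Gamma\le \mathrm{Sp}(V)$ let $\mathcal S(\Gamma)$ be the set of symplectic reflections in $\Gamma$, i.e. of the $g\in\Gamma$ whose fixed space $V^g$ has codimension $2$. For $g\in\mathcal S(\Gamma)$ put $\omega_g(u,v)=\omega(\pi_g u,\pi_g v)$, where $\pi_g:V\to (V^g)^\perp$ is the projection along $V^g$. For a $\Gamma$-conjugation invariant function $\mathbf c:\mathcal S(\Gamma)\to\mathbb C$ the symplectic reflection algebra is $$\mathsf H_{\mathbf c}(\Gamma)=\big(T(V)\rtimes\Gamma\big)\Big/\Big\langle [u,v]-\sum_{g\in\mathcal S(\Gamma)}\mathbf c(g)\,\omega_g(u,v)\,g\ \Big|\ u,v\in V\Big\rangle .$$ Let $\mathbf c:\mathcal S(E(G))\to\mathbb C$ be $E(G)$-conjugation invariant. Every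 symplectic reflection of $E(G)$ lies in exactly one of $G_0^\vee$ and $D_d$; let $\mathbf c_1$ be the function that equals $\mathbf c$ on $\mathcal S(G_0^\vee)$ and $0$ on $\mathcal S(D_d)$, let $\mathbf c_2$ be the function that equals $\mathbf c$ on $\mathcal S(D_d)$ and $0$ on $\mathcal S(G_0^\vee)$, and denote their restrictions to subgroups by the same letters. Write $\mathsf H_{\mathbf c_1}(G)$ for $\mathsf H_{\mathbf c_1}(G^\vee)$. An irreducible representation of $D_d$ is called $\mathbf c_2$-rigid if it is isomorphic to the restriction to $D_d$ of a simple $\mathsf H_{\mathbf c_2}(D_d)$-module. Let $L$ be a simple $\mathsf H_{\mathbf c_1}(G)$-module and let $$R(L)=\mathsf H_{\mathbf c_1}(E(G))\otimes_{\mathsf H_{\mathbf c_1}(G)}L .$$ Then $R(L)$ is an $\mathsf H_{\mathbf c}(E(G))$-module, in the sense that the action of $T(V)\rtimes E(G)$ on $R(L)$ through $\mathsf H_{\mathbf c_1}(E(G))$ factors through $\mathsf H_{\mathbf c}(E(G))$, if and only if all irreducible constituents of the restriction $R(L)|_{D_d}$ are $\mathbf c_2$-rigid. -/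

import Mathlib

open scoped TensorProduct MatrixGroups

noncomputable section

namespace SympRefl

/-! ### Fixed spaces and reflections -/

/-- The fixed space of an invertible matrix acting on column vectors. -/
def fixedSpace {n : Type} [Fintype n] [DecidableEq n] (g : GL n ℂ) : Submodule ℂ (n → ℂ) :=
  LinearMap.ker (Matrix.mulVecLin (g : Matrix n n ℂ) - LinearMap.id)

/-- A complex reflection: the fixed space has codimension `1`. -/
def IsReflection (g : GL (Fin 2) ℂ) : Prop :=
  Module.finrank ℂ ((Fin 2 → ℂ) ⧸ fixedSpace g) = 1

/-- The space `V = ℂ⁴`, with coordinates arranged as `ℂ² ⊕ ℂ²`. -/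
abbrev V : Type := Fin 2 ⊕ Fin 2 → ℂ

/-- The group `GL₄(ℂ) = GL(V)`. -/
abbrev GL4 : Type := GL (Fin 2 ⊕ Fin 2) ℂ

/-- A symplectic reflection: the fixed space has codimension `2` in `V`.  This is only used for
elements of groups that preserve the symplectic form `omega`. -/
def IsSympReflection (g : GL4) : Prop :=
  Module.finrank ℂ (V ⧸ fixedSpace g) = 2

/-- The standard symplectic form on `V`, `ω(u, v) = ∑ᵢ (uᵢ vᵢ₊₂ - uᵢ₊₂ vᵢ)`. -/
def omega : LinearMap.BilinForm ℂ V :=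
  Matrix.toBilin' (Matrix.fromBlocks 0 1 (-1) 0)

/-- The projection `π_g : V → (V^g)^⊥` along `V^g`, where the orthogonal space is taken with
respect to `omega`.  For a symplectic `g` of finite order `V = V^g ⊕ (V^g)^⊥` always holds; the
value `0` outside this situation is never relevant. -/
def reflProj (g : GL4) : V →ₗ[ℂ] V :=
  open Classical in
  if h : IsCompl (omega.orthogonal (fixedSpace g)) (fixedSpace g) then
    Submodule.projection _ _ h
  else 0

/-- The form `ω_g(u, v) = ω(π_g u, π_g v)`. -/
def omegaRefl (g : GL4) (u v : V) : ℂ :=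
  omega (reflProj g u) (reflProj g v)

/-! ### Symplectic reflection algebras -/

/-- The algebra endomorphism of `T(V)` induced by the action of `g` on `V`. -/
def tensorMap (g : GL4) : TensorAlgebra ℂ V →ₐ[ℂ] TensorAlgebra ℂ V :=
  TensorAlgebra.lift ℂ (TensorAlgebra.ι ℂ ∘ₗ Matrix.mulVecLin (g : Matrix _ _ ℂ))

theorem tensorMap_one : tensorMap 1 = AlgHom.id ℂ _ := by
  ext v
  simp [tensorMap]

theorem tensorMap_mul (g h : GL4) : tensorMap (g * h) = (tensorMap g).comp (tensorMap h) := by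
  ext v
  simp [tensorMap]

/-- `GL(V)` acts on the tensor algebra `T(V)` by algebra automorphisms. -/
instance tensorAction : MulSemiringAction GL4 (TensorAlgebra ℂ V) where
  smul g x := tensorMap g x
  one_smul x := DFunLike.congr_fun tensorMap_one x
  mul_smul g h x := DFunLike.congr_fun (tensorMap_mul g h) x
  smul_zero g := map_zero (tensorMap g)
  smul_add g := map_add (tensorMap g)
  smul_one g := map_one (tensorMap g)
  smul_mul g := map_mul (tensorMap g)

instance tensorAction_smulCommClass : SMulCommClass GL4 ℂ (TensorAlgebra ℂ V) where
  smul_comm g a x := map_smul (tensorMap g) a x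

instance tensorAction_smulCommClass_subgroup (Γ : Subgroup GL4) :
    SMulCommClass Γ ℂ (TensorAlgebra ℂ V) where
  smul_comm g a x := smul_comm (g : GL4) a x

/-- The skew group algebra `T(V) ⋊ Γ`. -/
abbrev SkewGroupAlgebra (Γ : Subgroup GL4) : Type :=
  SkewMonoidAlgebra (TensorAlgebra ℂ V) Γ

/-- A vector of `V` as an element of `T(V) ⋊ Γ`. -/
def vec (Γ : Subgroup GL4) (v : V) : SkewGroupAlgebra Γ :=
  SkewMonoidAlgebra.single 1 (TensorAlgebra.ι ℂ v)

/-- The element `∑_{g ∈ 𝒮(Γ)} c(g) ω_g(u, v) g` of `T(V) ⋊ Γ` (`Γ` is a finite group in all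
uses).  Only the values of `c` on symplectic reflections in `Γ` matter. -/
def reflSum (c : GL4 → ℂ) (Γ : Subgroup GL4) (u v : V) : SkewGroupAlgebra Γ :=
  ∑ᶠ (g : Γ) (_ : IsSympReflection (g : GL4)),
    SkewMonoidAlgebra.single g (algebraMap ℂ (TensorAlgebra ℂ V) (c g * omegaRefl g u v))

/-- The defining relations `[u, v] = ∑_{g ∈ 𝒮(Γ)} c(g) ω_g(u, v) g`. -/
inductive Rel (c : GL4 → ℂ) (Γ : Subgroup GL4) :
    SkewGroupAlgebra Γ → SkewGroupAlgebra Γ → Prop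
  | comm (u v : V) : Rel c Γ (vec Γ u * vec Γ v - vec Γ v * vec Γ u) (reflSum c Γ u v)

/-- The symplectic reflection algebra `H_c(Γ) = H_c(V, Γ)`. -/
abbrev H (c : GL4 → ℂ) (Γ : Subgroup GL4) : Type := RingQuot (Rel c Γ)

/-- The quotient map `T(V) ⋊ Γ → H_c(Γ)`. -/
def toH (c : GL4 → ℂ) (Γ : Subgroup GL4) : SkewGroupAlgebra Γ →ₐ[ℂ] H c Γ :=
  RingQuot.mkAlgHom ℂ (Rel c Γ)

/-- The algebra map `ℂ[Δ] → H_c(Γ)` for a subgroup `Δ ≤ Γ`. -/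
def groupAlgebraToH (c : GL4 → ℂ) {Δ Γ : Subgroup GL4} (h : Δ ≤ Γ) :
    MonoidAlgebra ℂ Δ →ₐ[ℂ] H c Γ :=
  MonoidAlgebra.lift ℂ (H c Γ) Δ
    (((toH c Γ : SkewGroupAlgebra Γ →* H c Γ).comp
      (SkewMonoidAlgebra.of (TensorAlgebra ℂ V) Γ)).comp (Subgroup.inclusion h))

/-- The inclusion `T(V) ⋊ Δ → T(V) ⋊ Γ` for a subgroup `Δ ≤ Γ`. -/
def skewIncl {Δ Γ : Subgroup GL4} (h : Δ ≤ Γ) : SkewGroupAlgebra Δ →ₐ[ℂ] SkewGroupAlgebra Γ :=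
  SkewMonoidAlgebra.mapDomainAlgHom ℂ (TensorAlgebra ℂ V) (f := Subgroup.inclusion h)
    (fun _ _ => rfl)

theorem skewIncl_single {Δ Γ : Subgroup GL4} (h : Δ ≤ Γ) (g : Δ) (x : TensorAlgebra ℂ V) :
    skewIncl h (SkewMonoidAlgebra.single g x) =
      SkewMonoidAlgebra.single (Subgroup.inclusion h g) x := by
  exact SkewMonoidAlgebra.mapDomain_single

theorem skewIncl_injective {Δ Γ : Subgroup GL4} (h : Δ ≤ Γ) :
    Function.Injective (skewIncl h) := by
  intro x y hxy
  apply SkewMonoidAlgebra.coeff_injective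
  apply Finsupp.mapDomain_injective (Subgroup.inclusion_injective h)
  have := congrArg SkewMonoidAlgebra.coeff hxy
  change (SkewMonoidAlgebra.mapDomain _ x).coeff = (SkewMonoidAlgebra.mapDomain _ y).coeff at this
  simpa only [SkewMonoidAlgebra.coeff_mapDomain] using this

theorem skewIncl_reflSum (c : GL4 → ℂ) {Δ Γ : Subgroup GL4} (h : Δ ≤ Γ)
    (hc : ∀ g ∈ Γ, g ∉ Δ → c g = 0) (u v : V) :
    skewIncl h (reflSum c Δ u v) = reflSum c Γ u v := by
  classical
  have hD : reflSum c Δ u v = ∑ᶠ g : Δ, SkewMonoidAlgebra.single g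
      (algebraMap ℂ (TensorAlgebra ℂ V)
        (if IsSympReflection (g : GL4) then c g * omegaRefl g u v else 0)) := by
    refine finsum_congr fun g => ?_
    by_cases hg : IsSympReflection (g : GL4) <;> simp [hg]
  have hG : reflSum c Γ u v = ∑ᶠ g : Γ, SkewMonoidAlgebra.single g
      (algebraMap ℂ (TensorAlgebra ℂ V)
        (if IsSympReflection (g : GL4) then c g * omegaRefl g u v else 0)) := by
    refine finsum_congr fun g => ?_
    by_cases hg : IsSympReflection (g : GL4) <;> simp [hg]
  rw [hD, hG]
  have key := AddMonoidHom.map_finsum_of_injective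
    (skewIncl h : SkewGroupAlgebra Δ →+ SkewGroupAlgebra Γ) (skewIncl_injective h)
    (fun g : Δ => SkewMonoidAlgebra.single g (algebraMap ℂ (TensorAlgebra ℂ V)
      (if IsSympReflection (g : GL4) then c g * omegaRefl g u v else 0)))
  refine key.trans ?_
  simp only [AddMonoidHom.coe_coe, skewIncl_single]
  refine (finsum_mem_range (f := fun g : Γ => SkewMonoidAlgebra.single g
    (algebraMap ℂ (TensorAlgebra ℂ V)
      (if IsSympReflection (g : GL4) then c g * omegaRefl g u v else 0)))
    (Subgroup.inclusion_injective h)).symm.trans ?_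
  refine (finsum_mem_inter_support _ _).symm.trans (Eq.trans ?_ (finsum_mem_univ _))
  rw [← finsum_mem_inter_support _ Set.univ]
  refine finsum_mem_congr (Set.ext fun g => ?_) fun _ _ => rfl
  simp only [Set.mem_inter_iff, Set.mem_range, Set.mem_univ, true_and, and_iff_right_iff_imp,
    Function.mem_support]
  intro hg
  by_contra hn
  have : (g : GL4) ∉ Δ := fun hm => hn ⟨⟨g, hm⟩, rfl⟩
  exact hg (by simp [hc g g.2 this])

/-- The algebra map `H_c(Δ) → H_c(Γ)` induced by the inclusion of a subgroup `Δ ≤ Γ`, for a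
parameter `c` that vanishes on `Γ` outside `Δ`. -/
def inclH (c : GL4 → ℂ) {Δ Γ : Subgroup GL4} (h : Δ ≤ Γ)
    (hc : ∀ g ∈ Γ, g ∉ Δ → c g = 0) : H c Δ →ₐ[ℂ] H c Γ :=
  RingQuot.liftAlgHom ℂ ⟨(toH c Γ).comp (skewIncl h), by
    rintro _ _ ⟨u, v⟩
    have hv : ∀ w : V, skewIncl h (vec Δ w) = vec Γ w := fun w => by
      simp [vec, skewIncl_single]
    rw [AlgHom.comp_apply, AlgHom.comp_apply, skewIncl_reflSum c h hc, map_sub, map_mul, map_mul,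
      hv, hv]
    exact RingQuot.mkAlgHom_rel ℂ (Rel.comm u v)⟩

/-! ### Change of rings for modules over noncommutative rings -/

/-- The induced module `B ⊗_A L` along a ring map `f : A → B`: the quotient of `B ⊗_ℤ L` by the
relations `(b f(a)) ⊗ l = b ⊗ (a l)`. -/
abbrev Induced {A B : Type} [Ring A] [Ring B] (f : A →+* B) (L : Type*) [AddCommGroup L]
    [Module A L] : Type _ :=
  (B ⊗[ℤ] L) ⧸ Submodule.span B
    {x : B ⊗[ℤ] L | ∃ (b : B) (a : A) (l : L), x = (b * f a) ⊗ₜ[ℤ] l - b ⊗ₜ[ℤ] (a • l)}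

/-- A `B`-module `M`, regarded as an `A`-module along a ring map `f : A → B`. -/
def Res {A B : Type} [Ring A] [Ring B] (_f : A →+* B) (M : Type*) : Type _ := M

instance {A B : Type} [Ring A] [Ring B] (f : A →+* B) (M : Type*) [AddCommGroup M] :
    AddCommGroup (Res f M) := inferInstanceAs (AddCommGroup M)

instance {A B : Type} [Ring A] [Ring B] (f : A →+* B) (M : Type*) [AddCommGroup M]
    [Module B M] : Module A (Res f M) := Module.compHom M f

/-! ### Modules over different symplectic reflection algebras -/

/-- The `H_{c'}(Γ)`-module `M` is an `H_c(Γ)`-module: the action of `T(V) ⋊ Γ` on `M` factors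
through `H_c(Γ)`. -/
def IsModuleFor (c : GL4 → ℂ) {c' : GL4 → ℂ} {Γ : Subgroup GL4} (M : Type*) [AddCommGroup M]
    [Module (H c' Γ) M] : Prop :=
  ∃ inst : Module (H c Γ) M, ∀ (a : SkewGroupAlgebra Γ) (m : M),
    inst.smul (toH c Γ a) m = toH c' Γ a • m

/-- A representation `W` of `D` is `c`-rigid if it is irreducible and isomorphic to the restriction
to `D` of a simple `H_c(D)`-module `M`. -/
def IsRigid.{u} (c : GL4 → ℂ) (D : Subgroup GL4) (W : Type u) [AddCommGroup W]
    [Module (MonoidAlgebra ℂ D) W] : Prop :=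
  IsSimpleModule (MonoidAlgebra ℂ D) W ∧
    ∃ (M : Type u) (_ : AddCommGroup M) (_ : Module (H c D) M),
      IsSimpleModule (H c D) M ∧
        Nonempty (W ≃ₗ[MonoidAlgebra ℂ D] Res (A := MonoidAlgebra ℂ D) (B := H c D)
          (groupAlgebraToH c (le_refl D)).toRingHom M)

/-- All constituents of the `ℂ[D]`-module `W` (its irreducible subrepresentations) are
`c`-rigid. -/
def AllConstituentsRigid (c : GL4 → ℂ) (D : Subgroup GL4) (W : Type*) [AddCommGroup W]
    [Module (MonoidAlgebra ℂ D) W] : Prop :=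
  ∀ N : Submodule (MonoidAlgebra ℂ D) W, IsSimpleModule (MonoidAlgebra ℂ D) N → IsRigid c D N

/-! ### The groups `G`, `E(G)`, `G₀` and `D_d` -/

/-- The group `μ_d` of scalar matrices `ζ I₂` with `ζ ^ d = 1`. -/
def mu (d : ℕ) : Subgroup (GL (Fin 2) ℂ) :=
  (rootsOfUnity d ℂ).map (Matrix.GeneralLinearGroup.scalar (Fin 2))

/-- `Γ` is a binary polyhedral group `⟨2, 3, n⟩`: a finite subgroup of `SL₂(ℂ)` generated by
elements `r, s, t` with `r² = s³ = tⁿ = r s t = -1`.  For `n = 3, 4, 5` such a subgroup exists and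
is unique up to conjugacy, and it is the binary tetrahedral group (of order 24), the binary
octahedral group (of order 48) and the binary icosahedral group (of order 120) respectively. -/
def IsBinaryPolyhedral (n : ℕ) (Γ : Subgroup (GL (Fin 2) ℂ)) : Prop :=
  Finite Γ ∧ (∀ g ∈ Γ, (g : Matrix (Fin 2) (Fin 2) ℂ).det = 1) ∧
    ∃ r s t : GL (Fin 2) ℂ, r ^ 2 = -1 ∧ s ^ 3 = -1 ∧ t ^ n = -1 ∧ r * s * t = -1 ∧
      Subgroup.closure {r, s, t} = Γ

/-- `T` is a binary tetrahedral group. -/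
def IsBinaryTetrahedral (T : Subgroup (GL (Fin 2) ℂ)) : Prop := IsBinaryPolyhedral 3 T

/-- `O` is a binary octahedral group. -/
def IsBinaryOctahedral (O : Subgroup (GL (Fin 2) ℂ)) : Prop := IsBinaryPolyhedral 4 O

/-- `I` is a binary icosahedral group. -/
def IsBinaryIcosahedral (I : Subgroup (GL (Fin 2) ℂ)) : Prop := IsBinaryPolyhedral 5 I

/-- `G` is the group `OT_d = ⋃_{k even} ζ_{2d}^k T ∪ ⋃_{k odd} ζ_{2d}^k ω T`, where `T` is a binary
tetrahedral subgroup of a binary octahedral group `O` and `ω ∈ O \ T`. -/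
def IsOT (d : ℕ) (G : Subgroup (GL (Fin 2) ℂ)) : Prop :=
  ∃ T O : Subgroup (GL (Fin 2) ℂ), IsBinaryTetrahedral T ∧ IsBinaryOctahedral O ∧ T ≤ O ∧
    ∃ w ∈ O, w ∉ T ∧ ∃ ζ : ℂˣ, IsPrimitiveRoot ζ (2 * d) ∧
      ∀ x : GL (Fin 2) ℂ, x ∈ G ↔ ∃ k : ℕ, ∃ t ∈ T,
        (Even k ∧ x = Matrix.GeneralLinearGroup.scalar (Fin 2) (ζ ^ k) * t) ∨
        (Odd k ∧ x = Matrix.GeneralLinearGroup.scalar (Fin 2) (ζ ^ k) * w * t)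

/-- The four infinite families of groups `G ≤ GL₂(ℂ)`: `μ_d T` with `6 ∣ d`, `μ_d O` with `4 ∣ d`,
`μ_d I` with `d` divisible by `4`, `6` or `10`, and `OT_{2d}` with `4 ∤ d`.  As scalar matrices are
central, the join of `μ_d` and `T` is the product `μ_d T`. -/
def IsListed (G : Subgroup (GL (Fin 2) ℂ)) : Prop :=
  ∃ d : ℕ, 0 < d ∧
    ((6 ∣ d ∧ ∃ T, IsBinaryTetrahedral T ∧ G = mu d ⊔ T) ∨
     (4 ∣ d ∧ ∃ O, IsBinaryOctahedral O ∧ G = mu d ⊔ O) ∨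
     ((4 ∣ d ∨ 6 ∣ d ∨ 10 ∣ d) ∧ ∃ I, IsBinaryIcosahedral I ∧ G = mu d ⊔ I) ∨
     (¬ 4 ∣ d ∧ IsOT (2 * d) G))

/-- The map `g ↦ g^∨ = diag(g, (gᵀ)⁻¹)`. -/
def vee : GL (Fin 2) ℂ →* GL4 where
  toFun g :=
    { val := Matrix.fromBlocks g.val 0 0 g.inv.transpose
      inv := Matrix.fromBlocks g.inv 0 0 g.val.transpose
      val_inv := by
        rw [Matrix.fromBlocks_multiply, ← Matrix.transpose_mul]
        simp
      inv_val := by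
        rw [Matrix.fromBlocks_multiply, ← Matrix.transpose_mul]
        simp }
  map_one' := by
    ext1
    simp
  map_mul' g h := by
    ext1
    simp [Matrix.fromBlocks_multiply, Matrix.transpose_mul]

/-- The matrix `s`, with rows `(0,0,0,1)`, `(0,0,-1,0)`, `(0,-1,0,0)`, `(1,0,0,0)`. -/
def sMat : Matrix (Fin 2 ⊕ Fin 2) (Fin 2 ⊕ Fin 2) ℂ :=
  Matrix.fromBlocks 0 !![0, 1; -1, 0] !![0, -1; 1, 0] 0

theorem sMat_mul_self : sMat * sMat = 1 := by
  rw [sMat, Matrix.fromBlocks_multiply, ← Matrix.fromBlocks_one]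
  congr 1 <;> simp [Matrix.one_fin_two]

/-- The symplectic reflection `s` as an element of `GL₄(ℂ)`. -/
def s : GL4 := ⟨sMat, sMat, sMat_mul_self, sMat_mul_self⟩

/-- The group `E(G) = {g^∨, g^∨ s ∣ g ∈ G}`.  For the groups `G` in the four families this set is
already closed under multiplication. -/
def E (G : Subgroup (GL (Fin 2) ℂ)) : Subgroup GL4 :=
  Subgroup.closure {x | ∃ g ∈ G, x = vee g ∨ x = vee g * s}

/-- The group `G^∨`. -/
def Gvee (G : Subgroup (GL (Fin 2) ℂ)) : Subgroup GL4 := G.map vee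

/-- The largest complex reflection group `G₀` in `G`, generated by all reflections in `G`. -/
def G₀ (G : Subgroup (GL (Fin 2) ℂ)) : Subgroup (GL (Fin 2) ℂ) :=
  Subgroup.closure {g | g ∈ G ∧ IsReflection g}

/-- The dihedral group `D_d = ⟨Z(G)^∨, s⟩`, where `Z(G) = μ_d`. -/
def D (G : Subgroup (GL (Fin 2) ℂ)) : Subgroup GL4 :=
  Subgroup.closure (vee '' {z | z ∈ G ∧ ∀ g ∈ G, g * z = z * g} ∪ {s})

theorem Gvee_le_E (G : Subgroup (GL (Fin 2) ℂ)) : Gvee G ≤ E G := by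
  rintro _ ⟨g, hg, rfl⟩
  exact Subgroup.subset_closure ⟨g, hg, Or.inl rfl⟩

theorem D_le_E (G : Subgroup (GL (Fin 2) ℂ)) : D G ≤ E G := by
  rw [D, Subgroup.closure_le]
  rintro _ (⟨z, ⟨hz, _⟩, rfl⟩ | rfl)
  · exact Subgroup.subset_closure ⟨z, hz, Or.inl rfl⟩
  · exact Subgroup.subset_closure ⟨1, G.one_mem, Or.inr (by simp)⟩

theorem G₀_le (G : Subgroup (GL (Fin 2) ℂ)) : G₀ G ≤ G := by
  rw [G₀, Subgroup.closure_le]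
  exact fun g hg => hg.1

/-! ### Splitting the parameter -/

/-- `c` is a parameter for `H_c(Γ)`: it is invariant under `Γ`-conjugation on the symplectic
reflections in `Γ`.  (A function on `𝒮(Γ)` is given here as a function on `GL₄(ℂ)`, whose other
values are irrelevant.) -/
def IsParameter (c : GL4 → ℂ) (Γ : Subgroup GL4) : Prop :=
  ∀ h ∈ Γ, ∀ g ∈ Γ, IsSympReflection g → c (h * g * h⁻¹) = c g

/-- The part `c₁` of `c` that agrees with `c` on `𝒮(G₀^∨)` and vanishes elsewhere. -/
def c₁ (G : Subgroup (GL (Fin 2) ℂ)) (c : GL4 → ℂ) : GL4 → ℂ :=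
  open Classical in fun g => if g ∈ (G₀ G).map vee then c g else 0

/-- The part `c₂` of `c` that agrees with `c` on `𝒮(D_d)` and vanishes elsewhere. -/
def c₂ (G : Subgroup (GL (Fin 2) ℂ)) (c : GL4 → ℂ) : GL4 → ℂ :=
  open Classical in fun g => if g ∈ D G then c g else 0

theorem c₁_eq_zero (G : Subgroup (GL (Fin 2) ℂ)) (c : GL4 → ℂ) :
    ∀ g ∈ E G, g ∉ Gvee G → c₁ G c g = 0 := by
  intro g _ hg
  exact if_neg fun h => hg (Subgroup.map_mono (G₀_le G) h)

/-- The map `H_{c₁}(G) → H_{c₁}(E(G))`. -/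
def inclHE (G : Subgroup (GL (Fin 2) ℂ)) (c : GL4 → ℂ) :
    H (c₁ G c) (Gvee G) →ₐ[ℂ] H (c₁ G c) (E G) :=
  inclH (c₁ G c) (Gvee_le_E G) (c₁_eq_zero G c)

/-- The `H_{c₁}(E(G))`-module `R(L) = H_{c₁}(E(G)) ⊗_{H_{c₁}(G)} L`. -/
abbrev R (G : Subgroup (GL (Fin 2) ℂ)) (c : GL4 → ℂ) (L : Type*) [AddCommGroup L]
    [Module (H (c₁ G c) (Gvee G)) L] : Type _ :=
  Induced (A := H (c₁ G c) (Gvee G)) (B := H (c₁ G c) (E G)) (inclHE G c).toRingHom L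

/-- The representation `R(L)|_{D_d}`. -/
abbrev RestrictedR (G : Subgroup (GL (Fin 2) ℂ)) (c : GL4 → ℂ) (L : Type*) [AddCommGroup L]
    [Module (H (c₁ G c) (Gvee G)) L] : Type _ :=
  Res (A := MonoidAlgebra ℂ (D G)) (B := H (c₁ G c) (E G))
    (groupAlgebraToH (c₁ G c) (D_le_E G)).toRingHom (R G c L)

end SympRefl

end

noncomputable section

namespace SympRefl

/-! ### Sums over symplectic reflections in a group algebra -/

/-! Let `M` be any module over `H_{c₁}(E(G))`. There `[u, v]` already acts by the `c₁`-weighted sum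
over reflections, so `M` is an `H_c(E(G))`-module exactly when the `c`-sums and the `c₁`-sums act
alike (`isModuleFor_iff`). Each symplectic reflection of `E(G)` lies in exactly one of `G₀^∨` and
`D`, so `c = c₁ + c₂` on reflections, and the condition becomes that the `c₂`-sums, which are
elements of `ℂ[D]`, annihilate `M`.

Rigidity expresses the same condition on constituents. The central element `-1 ∈ D` acts by a sign
on an irreducible representation but anticommutes with `V`, so `V` acts by zero on every
`H_{c₂}(D)`-module that is irreducible over `D`. Hence an irreducible representation is rigid iff
the `c₂`-sums kill it (`isRigid_iff`), and Maschke's theorem passes from the constituents to all of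
`M|_D` (`allConstituentsRigid_iff`).

The splitting of the reflections rests on `s g^∨ = ((det g)⁻¹ g)^∨ s` (`s_mul_vee`). As `G` contains
the scalars `det g`, every element of `E(G)` is some `g^∨` or `g^∨ s`. If `g^∨` is a symplectic
reflection, then `g` is a complex reflection; if `g^∨ s` is one, then `g` is scalar
(`mem_range_scalars_of_isSympReflection`), so `g^∨ s ∈ D`. Since `G` is not commutative, its centre
is scalar, so the elements `g^∨` of `D` have `g` scalar and are not reflections. -/

/-- The element `∑_{g ∈ 𝒮(Γ)} c(g) ω_g(u, v) g` of the group algebra `ℂ[Γ]`. -/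
def groupReflSum (c : GL4 → ℂ) (Γ : Subgroup GL4) (u v : V) : MonoidAlgebra ℂ Γ :=
  ∑ᶠ (g : Γ) (_ : IsSympReflection (g : GL4)), MonoidAlgebra.single g (c g * omegaRefl g u v)

/-- The inclusion `ℂ[Γ] → T(V) ⋊ Γ`. -/
def groupAlgebraToSkew (Γ : Subgroup GL4) : MonoidAlgebra ℂ Γ →ₐ[ℂ] SkewGroupAlgebra Γ :=
  MonoidAlgebra.lift ℂ (SkewGroupAlgebra Γ) Γ (SkewMonoidAlgebra.of (TensorAlgebra ℂ V) Γ)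

theorem groupAlgebraToSkew_single (Γ : Subgroup GL4) (g : Γ) (a : ℂ) :
    groupAlgebraToSkew Γ (MonoidAlgebra.single g a) =
      SkewMonoidAlgebra.single g (algebraMap ℂ (TensorAlgebra ℂ V) a) := by
  rw [groupAlgebraToSkew, MonoidAlgebra.lift_single, SkewMonoidAlgebra.of_apply,
    SkewMonoidAlgebra.smul_single, Algebra.algebraMap_eq_smul_one]

/-- The right side of the defining relation involves no vectors, so it can be handled inside `ℂ[Γ]`.
-/
theorem groupAlgebraToSkew_groupReflSum (c : GL4 → ℂ) (Γ : Subgroup GL4) [Finite Γ] (u v : V) :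
    groupAlgebraToSkew Γ (groupReflSum c Γ u v) = reflSum c Γ u v := by
  rw [groupReflSum, reflSum, map_finsum _ (Set.toFinite _)]
  refine finsum_congr fun g => ?_
  by_cases hg : IsSympReflection (g : GL4) <;> simp [hg, groupAlgebraToSkew_single]

theorem reflSum_add {c c' c'' : GL4 → ℂ} (Γ : Subgroup GL4) [Finite Γ]
    (h : ∀ g ∈ Γ, IsSympReflection g → c g = c' g + c'' g) (u v : V) :
    reflSum c Γ u v = reflSum c' Γ u v + reflSum c'' Γ u v := by
  rw [reflSum, reflSum, reflSum, ← finsum_add_distrib (Set.toFinite _) (Set.toFinite _)]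
  refine finsum_congr fun g => ?_
  by_cases hg : IsSympReflection (g : GL4)
  · simp only [hg, finsum_true, h g g.2 hg, add_mul, map_add, SkewMonoidAlgebra.single_add]
  · simp [hg]

theorem groupAlgebraToH_apply (c : GL4 → ℂ) {Δ Γ : Subgroup GL4} (h : Δ ≤ Γ)
    (x : MonoidAlgebra ℂ Δ) :
    groupAlgebraToH c h x = toH c Γ (skewIncl h (groupAlgebraToSkew Δ x)) := by
  suffices groupAlgebraToH c h = ((toH c Γ).comp (skewIncl h)).comp (groupAlgebraToSkew Δ) from
    DFunLike.congr_fun this x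
  refine MonoidAlgebra.algHom_ext (fun g => ?_) (Subsingleton.elim _ _)
  rw [AlgHom.comp_apply, AlgHom.comp_apply, groupAlgebraToSkew_single, skewIncl_single,
    groupAlgebraToH, MonoidAlgebra.lift_single]
  simp [SkewMonoidAlgebra.of_apply]

theorem skewIncl_refl {Γ : Subgroup GL4} (x : SkewGroupAlgebra Γ) :
    skewIncl (le_refl Γ) x = x := by
  induction x using SkewMonoidAlgebra.induction_on with
  | zero => exact map_zero _
  | single g a => rw [skewIncl_single]; rfl
  | add x y hx hy => rw [map_add, hx, hy]

/-- The algebra map `T(V) ⋊ Γ → ℂ[Γ]` that sends `V` to `0`. -/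
def skewToGroupAlgebra (Γ : Subgroup GL4) : SkewGroupAlgebra Γ →ₐ[ℂ] MonoidAlgebra ℂ Γ :=
  SkewMonoidAlgebra.liftNCAlgHom
    ((Algebra.ofId ℂ (MonoidAlgebra ℂ Γ)).comp (TensorAlgebra.algebraMapInv (M := V)))
    (MonoidAlgebra.of ℂ Γ) (by
      intro x g
      -- The augmentation of `T(V)` kills `V`, hence is invariant under the linear action; this
      -- gives compatibility with the skew multiplication.
      have h : (TensorAlgebra.algebraMapInv (R := ℂ) (M := V)).comp (tensorMap g) =
          TensorAlgebra.algebraMapInv := by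
        ext v
        simp [tensorMap, TensorAlgebra.algebraMapInv]
      have hx : TensorAlgebra.algebraMapInv (g • x) = TensorAlgebra.algebraMapInv x :=
        DFunLike.congr_fun h x
      rw [AlgHom.comp_apply, AlgHom.comp_apply, hx]
      exact Algebra.commutes _ _)

theorem skewToGroupAlgebra_single (Γ : Subgroup GL4) (g : Γ) (x : TensorAlgebra ℂ V) :
    skewToGroupAlgebra Γ (SkewMonoidAlgebra.single g x) =
      MonoidAlgebra.single g (TensorAlgebra.algebraMapInv x) := by
  refine (SkewMonoidAlgebra.liftNC_single _ _ g x).trans ?_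
  simp [Algebra.ofId_apply]

theorem skewToGroupAlgebra_vec (Γ : Subgroup GL4) (v : V) :
    skewToGroupAlgebra Γ (vec Γ v) = 0 := by
  rw [vec, skewToGroupAlgebra_single]
  simp [TensorAlgebra.algebraMapInv]

theorem skewToGroupAlgebra_groupAlgebraToSkew (Γ : Subgroup GL4) (x : MonoidAlgebra ℂ Γ) :
    skewToGroupAlgebra Γ (groupAlgebraToSkew Γ x) = x := by
  suffices (skewToGroupAlgebra Γ).comp (groupAlgebraToSkew Γ) = AlgHom.id ℂ _ from
    DFunLike.congr_fun this x
  refine MonoidAlgebra.algHom_ext (fun g => ?_) (Subsingleton.elim _ _)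
  rw [AlgHom.comp_apply, groupAlgebraToSkew_single, skewToGroupAlgebra_single]
  simp

/-! ### Modules over symplectic reflection algebras -/

theorem toH_commutator (c : GL4 → ℂ) (Γ : Subgroup GL4) (u v : V) :
    toH c Γ (vec Γ u * vec Γ v - vec Γ v * vec Γ u) = toH c Γ (reflSum c Γ u v) :=
  RingQuot.mkAlgHom_rel ℂ (Rel.comm u v)

/-- An action of `T(V) ⋊ Γ` that satisfies the defining relations makes a module over
`H_c(Γ)`. -/
theorem exists_module_H (c : GL4 → ℂ) (Γ : Subgroup GL4) {M : Type*} [AddCommGroup M]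
    (φ : SkewGroupAlgebra Γ →+* AddMonoid.End M)
    (hφ : ∀ u v, φ (vec Γ u * vec Γ v - vec Γ v * vec Γ u) = φ (reflSum c Γ u v)) :
    ∃ inst : Module (H c Γ) M, ∀ (a : SkewGroupAlgebra Γ) (m : M),
      inst.smul (toH c Γ a) m = φ a m := by
  let ψ : H c Γ →+* AddMonoid.End M := RingQuot.lift ⟨φ, by
    rintro _ _ ⟨u, v⟩
    exact hφ u v⟩
  refine ⟨Module.compHom M ψ, fun a m => ?_⟩
  have h : toH c Γ a = RingQuot.mkRingHom (Rel c Γ) a :=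
    DFunLike.congr_fun (RingQuot.mkAlgHom_coe ℂ (Rel c Γ)) a
  have h' : ψ (toH c Γ a) = φ a := by
    rw [h]
    exact RingQuot.lift_mkRingHom_apply φ _ a
  exact DFunLike.congr_fun h' m

theorem isModuleFor_iff (c : GL4 → ℂ) {c' : GL4 → ℂ} {Γ : Subgroup GL4} (M : Type*)
    [AddCommGroup M] [Module (H c' Γ) M] :
    IsModuleFor c (c' := c') (Γ := Γ) M ↔ ∀ (u v : V) (m : M),
      toH c' Γ (reflSum c' Γ u v) • m = toH c' Γ (reflSum c Γ u v) • m := by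
  constructor
  · rintro ⟨inst, h⟩ u v m
    rw [← toH_commutator, ← h, ← h, toH_commutator]
  · intro h
    refine exists_module_H c Γ
      ((Module.toAddMonoidEnd (H c' Γ) M).comp (toH c' Γ : SkewGroupAlgebra Γ →+* H c' Γ))
      fun u v => ?_
    ext m
    change toH c' Γ _ • m = toH c' Γ _ • m
    rw [toH_commutator, h]

/-! ### Rigid representations -/

/-- A central element of square one acts on a simple module by `1` or by `-1`. -/
theorem smul_eq_self_or_neg_of_isSimpleModule {A W : Type*} [Ring A] [AddCommGroup W] [Module A W]
    [IsSimpleModule A W] {z : A} (hz : ∀ a, a * z = z * a) (hz2 : z * z = 1) :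
    (∀ w : W, z • w = w) ∨ ∀ w : W, z • w = -w := by
  let K : Submodule A W :=
    { carrier := {w | z • w = w}
      add_mem' := fun {a b} ha hb => by
        change z • (a + b) = a + b
        rw [smul_add, show z • a = a from ha, show z • b = b from hb]
      zero_mem' := smul_zero z
      smul_mem' := fun a w hw => by
        change z • a • w = a • w
        rw [smul_smul, ← hz, mul_smul, show z • w = w from hw] }
  rcases eq_bot_or_eq_top K with hK | hK
  · right
    intro w
    -- `z (z + 1) = z + 1` because `z² = 1`, so the image of `z + 1` is fixed by `z`.
    have h : z • w + w ∈ K := by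
      change z • (z • w + w) = z • w + w
      rw [smul_add, smul_smul, hz2, one_smul, add_comm]
    rw [hK, Submodule.mem_bot] at h
    exact eq_neg_of_add_eq_zero_left h
  · left
    intro w
    exact show w ∈ K from hK ▸ Submodule.mem_top

theorem of_mul_vec (Γ : Subgroup GL4) (g : Γ) (v : V) :
    SkewMonoidAlgebra.of (TensorAlgebra ℂ V) Γ g * vec Γ v =
      vec Γ (Matrix.mulVec (g : GL4).val v) * SkewMonoidAlgebra.of (TensorAlgebra ℂ V) Γ g := by
  have h : g • TensorAlgebra.ι ℂ v = TensorAlgebra.ι ℂ (Matrix.mulVec (g : GL4).val v) := by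
    change tensorMap (g : GL4) _ = _
    simp [tensorMap]
  simp only [SkewMonoidAlgebra.of_apply, vec, SkewMonoidAlgebra.single_mul_single, h, one_mul,
    mul_one, smul_one]

theorem vec_neg_add_vec (Γ : Subgroup GL4) (v : V) : vec Γ (-v) + vec Γ v = 0 := by
  rw [vec, vec, ← SkewMonoidAlgebra.single_add, ← map_add, neg_add_cancel, map_zero,
    SkewMonoidAlgebra.single_zero]

/-- If `-1 ∈ D`, then `V` acts by zero on every `H_c(D)`-module that is irreducible over `D`. -/
theorem toH_vec_smul_eq_zero (c : GL4 → ℂ) (D : Subgroup GL4) (hD : -1 ∈ D) {M : Type*}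
    [AddCommGroup M] [Module (H c D) M]
    (hM : IsSimpleModule (MonoidAlgebra ℂ D) (Res (A := MonoidAlgebra ℂ D) (B := H c D)
      (groupAlgebraToH c (le_refl D)).toRingHom M)) (v : V) (m : M) :
    toH c D (vec D v) • m = 0 := by
  let n : D := ⟨-1, hD⟩
  let z : MonoidAlgebra ℂ D := MonoidAlgebra.of ℂ D n
  let y : H c D := toH c D (SkewMonoidAlgebra.of (TensorAlgebra ℂ V) D n)
  have hn : ∀ g : D, g * n = n * g := fun g => Subtype.ext (by simp [n])
  have hn2 : n * n = 1 := Subtype.ext (by simp [n])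
  have hzc : ∀ a, a * z = z * a := by
    intro a
    induction a using MonoidAlgebra.induction_on with
    | of g => simp only [z, ← map_mul, hn]
    | add a b ha hb => rw [add_mul, mul_add, ha, hb]
    | smul r a ha => rw [smul_mul_assoc, mul_smul_comm, ha]
  have hz2 : z * z = 1 := by simp only [z, ← map_mul, hn2, map_one]
  have hzy : groupAlgebraToH c (le_refl D) z = y := by
    rw [groupAlgebraToH_apply, skewIncl_refl]
    simp [z, y, groupAlgebraToSkew]
  -- Moving `-1` past a vector negates the vector.
  have hyv : y * toH c D (vec D v) + toH c D (vec D v) * y = 0 := by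
    have hn' : Matrix.mulVec (n : GL4).val v = -v := by simp [n, Matrix.neg_mulVec]
    rw [← map_mul, of_mul_vec, hn', ← map_mul, ← map_add, ← add_mul, vec_neg_add_vec, zero_mul,
      map_zero]
  have hs : (∀ w : M, y • w = w) ∨ ∀ w : M, y • w = -w := by
    rw [← hzy]
    exact smul_eq_self_or_neg_of_isSimpleModule (W := Res (A := MonoidAlgebra ℂ D) (B := H c D)
      (groupAlgebraToH c (le_refl D)).toRingHom M) hzc hz2
  set x := toH c D (vec D v) with hx
  have h : y • x • m + x • y • m = 0 := by
    rw [← mul_smul, ← mul_smul, ← add_smul, hyv, zero_smul]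
  have h2 : x • m + x • m = 0 := by
    rcases hs with hs | hs
    · rwa [hs, hs] at h
    · rwa [hs, hs, smul_neg, ← neg_add, neg_eq_zero] at h
  -- `M` carries no separate `ℂ`-action, so division by two uses the scalar `2⁻¹` inside `H c D`.
  have h3 : (algebraMap ℂ (H c D) 2⁻¹ * algebraMap ℂ (H c D) 2) • x • m = 0 := by
    rw [mul_smul, map_ofNat, ofNat_smul_eq_nsmul, two_nsmul, h2, smul_zero]
  rw [← map_mul] at h3
  simpa using h3

/-- On a module realising `W`, `V` acts by zero, so all commutators vanish and the relations force
the reflection sums to vanish as well. Conversely, if these sums vanish, letting `V` act by zero on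
`W` satisfies the relations. -/
theorem isRigid_iff (c : GL4 → ℂ) (D : Subgroup GL4) [Finite D] (hD : -1 ∈ D) (W : Type*)
    [AddCommGroup W] [Module (MonoidAlgebra ℂ D) W] :
    IsRigid c D W ↔ IsSimpleModule (MonoidAlgebra ℂ D) W ∧
      ∀ (u v : V) (w : W), groupReflSum c D u v • w = 0 := by
  constructor
  · rintro ⟨hW, M, _, _, -, ⟨e⟩⟩
    refine ⟨hW, fun u v w => e.injective ?_⟩
    have hM := IsSimpleModule.congr e.symm
    rw [map_smul, map_zero]
    change groupAlgebraToH c (le_refl D) (groupReflSum c D u v) • (show M from e w) = (0 : M)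
    rw [groupAlgebraToH_apply, groupAlgebraToSkew_groupReflSum, skewIncl_refl, ← toH_commutator,
      map_sub, map_mul, map_mul, sub_smul, mul_smul, mul_smul]
    simp only [toH_vec_smul_eq_zero c D hD hM, sub_zero]
  · rintro ⟨hW, h⟩
    obtain ⟨inst, hinst⟩ := exists_module_H c D
      ((Module.toAddMonoidEnd (MonoidAlgebra ℂ D) W).comp
        (skewToGroupAlgebra D : SkewGroupAlgebra D →+* MonoidAlgebra ℂ D)) (by
      intro u v
      ext w
      change skewToGroupAlgebra D _ • w = skewToGroupAlgebra D _ • w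
      rw [← groupAlgebraToSkew_groupReflSum, skewToGroupAlgebra_groupAlgebraToSkew, h, map_sub,
        map_mul, map_mul, skewToGroupAlgebra_vec, skewToGroupAlgebra_vec]
      simp)
    have key : ∀ (x : MonoidAlgebra ℂ D) (w : W),
        groupAlgebraToH c (le_refl D) x • w = x • w := by
      intro x w
      rw [groupAlgebraToH_apply, skewIncl_refl]
      refine (hinst _ _).trans ?_
      change skewToGroupAlgebra D _ • w = _
      rw [skewToGroupAlgebra_groupAlgebraToSkew]
    let e : W ≃ₗ[MonoidAlgebra ℂ D] Res (A := MonoidAlgebra ℂ D) (B := H c D)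
        (groupAlgebraToH c (le_refl D)).toRingHom W :=
      { AddEquiv.refl W with map_smul' := fun x w => (key x w).symm }
    refine ⟨hW, W, inferInstance, inst, ?_, ⟨e⟩⟩
    have hne : Nontrivial W := IsSimpleModule.nontrivial (MonoidAlgebra ℂ D) W
    refine { eq_bot_or_eq_top := fun N => ?_ }
    -- An `H_c(D)`-submodule is in particular stable under `D`, so simplicity over `ℂ[D]` suffices.
    let N' : Submodule (MonoidAlgebra ℂ D) W :=
      { N.toAddSubmonoid with
        smul_mem' := fun x w hw => by
          rw [← key x w]
          exact N.smul_mem _ hw }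
    rcases eq_bot_or_eq_top N' with h' | h'
    · left
      ext w
      exact SetLike.ext_iff.1 h' w
    · right
      ext w
      exact SetLike.ext_iff.1 h' w

/-- By Maschke's theorem, the constituents of a representation of a finite group `D` are all
rigid if and only if the defining relations hold on it when `V` acts by zero. -/
theorem allConstituentsRigid_iff (c : GL4 → ℂ) (D : Subgroup GL4) [Finite D] (hD : -1 ∈ D)
    (W : Type*) [AddCommGroup W] [Module (MonoidAlgebra ℂ D) W] :
    AllConstituentsRigid c D W ↔ ∀ (u v : V) (w : W), groupReflSum c D u v • w = 0 := by
  constructor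
  · intro h u v w
    have hw : w ∈ ⨆ N : {N : Submodule (MonoidAlgebra ℂ D) W // IsSimpleModule (MonoidAlgebra ℂ D) N}, N.1 := by
      have : NeZero (Nat.card D : ℂ) := ⟨Nat.cast_ne_zero.2 Nat.card_pos.ne'⟩
      have := IsSemisimpleModule.sSup_simples_eq_top (MonoidAlgebra ℂ D) W
      rw [sSup_eq_iSup'] at this
      exact (SetLike.ext_iff.1 this w).2 Submodule.mem_top
    induction hw using Submodule.iSup_induction' with
    | mem N x hx =>
      exact congrArg Subtype.val (((isRigid_iff c D hD N.1).1 (h N.1 N.2)).2 u v ⟨x, hx⟩)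
    | zero => exact smul_zero _
    | add x y _ _ hx hy => rw [smul_add, hx, hy, add_zero]
  · intro h N hN
    exact (isRigid_iff c D hD N).2 ⟨hN, fun u v w => Subtype.ext (h u v w)⟩

/-! ### Scalar matrices -/

/-- The scalar matrices in `GL₂(ℂ)`. -/
abbrev scalars : ℂˣ →* GL (Fin 2) ℂ := Matrix.GeneralLinearGroup.scalar (Fin 2)

theorem scalars_val (a : ℂˣ) :
    (scalars a : Matrix (Fin 2) (Fin 2) ℂ) = Matrix.scalar (Fin 2) (a : ℂ) := rfl

theorem scalars_mul_comm (a : ℂˣ) (g : GL (Fin 2) ℂ) : scalars a * g = g * scalars a := by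
  ext1
  exact Matrix.scalar_commute (a : ℂ) (fun _ => Commute.all _ _) g.val

theorem mem_range_scalars {g : GL (Fin 2) ℂ} (h₁ : g.val 0 1 = 0) (h₂ : g.val 1 0 = 0)
    (h₃ : g.val 0 0 = g.val 1 1) : g ∈ scalars.range := by
  have hd : g.val.det ≠ 0 := (g.isUnit.map Matrix.detMonoidHom).ne_zero
  have h0 : g.val 0 0 ≠ 0 := by
    intro h
    rw [Matrix.det_fin_two, h, h₁] at hd
    simp at hd
  refine ⟨Units.mk0 _ h0, ?_⟩
  ext i j
  fin_cases i <;> fin_cases j <;> simp [h₁, h₂, h₃]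

/-- A matrix that commutes with two noncommuting `2 × 2` matrices is scalar. -/
theorem mem_range_scalars_of_commute {a b z : GL (Fin 2) ℂ} (hab : a * b ≠ b * a)
    (ha : a * z = z * a) (hb : b * z = z * b) : z ∈ scalars.range := by
  -- Two matrices commute iff the vectors `(x₀₁, x₁₀, x₀₀ - x₁₁)` attached to them are proportional,
  -- that is, all `2 × 2` minors vanish.
  have entries : ∀ x y : GL (Fin 2) ℂ, x * y = y * x ↔
      x.val 0 1 * y.val 1 0 = y.val 0 1 * x.val 1 0 ∧
      x.val 0 1 * (y.val 0 0 - y.val 1 1) = y.val 0 1 * (x.val 0 0 - x.val 1 1) ∧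
      x.val 1 0 * (y.val 0 0 - y.val 1 1) = y.val 1 0 * (x.val 0 0 - x.val 1 1) := by
    intro x y
    rw [Units.ext_iff, ← Matrix.ext_iff]
    simp only [Fin.forall_fin_two, Units.val_mul, Matrix.mul_apply, Fin.sum_univ_two]
    constructor
    · rintro ⟨⟨h1, h2⟩, h3, h4⟩
      refine ⟨?_, ?_, ?_⟩ <;> grind
    · rintro ⟨h1, h2, h3⟩
      refine ⟨⟨?_, ?_⟩, ?_, ?_⟩ <;> grind
  rw [entries] at ha hb
  rw [Ne, entries] at hab
  obtain ⟨ha1, ha2, ha3⟩ := ha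
  obtain ⟨hb1, hb2, hb3⟩ := hb
  by_contra hz
  apply hab
  -- For nonscalar `z` this vector is nonzero; the vectors of `a` and `b`, both proportional to it,
  -- are proportional to each other. The cases pick a nonzero coordinate to cancel.
  by_cases h1 : z.val 0 1 = 0
  · by_cases h2 : z.val 1 0 = 0
    · have h3 : z.val 0 0 - z.val 1 1 ≠ 0 :=
        fun h3 => hz (mem_range_scalars h1 h2 (sub_eq_zero.1 h3))
      refine ⟨?_, ?_, ?_⟩ <;> apply mul_left_cancel₀ h3 <;> grind
    · refine ⟨?_, ?_, ?_⟩ <;> apply mul_left_cancel₀ h2 <;> grind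
  · refine ⟨?_, ?_, ?_⟩ <;> apply mul_left_cancel₀ h1 <;> grind

/-! ### Multiplication in `E(G)` -/

theorem s_mul_s : s * s = 1 := Units.ext sMat_mul_self

theorem s_inv : s⁻¹ = s := inv_eq_of_mul_eq_one_left s_mul_s

theorem vee_neg_one : vee (-1) = -1 := by
  ext1
  change Matrix.fromBlocks (-1) 0 0 (Matrix.transpose (-1)) = -1
  rw [← Matrix.fromBlocks_one, Matrix.fromBlocks_neg]
  simp

theorem vee_ne_vee_mul_s (g h : GL (Fin 2) ℂ) : vee g ≠ vee h * s := by
  intro hgh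
  have h1 : Matrix.fromBlocks g.val 0 0 g.inv.transpose =
      Matrix.fromBlocks h.val 0 0 h.inv.transpose * sMat := congrArg Units.val hgh
  rw [sMat, Matrix.fromBlocks_multiply, Matrix.fromBlocks_inj] at h1
  have h2 : g.val = 0 := by simpa using h1.1
  exact g.ne_zero h2

/-- In size two this conjugation turns the transpose into the adjugate, and the adjugate of `g⁻¹` is
`det(g⁻¹) g`. -/
theorem conj_inv_transpose (g : GL (Fin 2) ℂ) :
    !![0, 1; -1, 0] * g.inv.transpose * !![0, -1; 1, 0] = g.inv.det • g.val := by
  have h : !![0, 1; -1, 0] * g.inv.transpose * !![0, -1; 1, 0] = g.inv.adjugate := by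
    rw [Matrix.adjugate_fin_two, Matrix.eta_fin_two g.inv.transpose]
    simp
  rw [h, ← one_mul g.inv.adjugate, ← g.val_inv, mul_assoc, Matrix.mul_adjugate, Matrix.mul_smul,
    mul_one]

/-- This commutation rule is why closure of `{g^∨, g^∨ s}` under products needs the scalars `det g`
in `G`. -/
theorem s_mul_vee (g : GL (Fin 2) ℂ) :
    s * vee g = vee (scalars (Matrix.GeneralLinearGroup.det g)⁻¹ * g) * s := by
  have hd : g.val.det * g.inv.det = 1 := by rw [← Matrix.det_mul, g.val_inv, Matrix.det_one]
  have h1 : (scalars (Matrix.GeneralLinearGroup.det g)⁻¹ * g).val = g.inv.det • g.val := by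
    change Matrix.scalar (Fin 2) g.inv.det * g.val = _
    rw [Matrix.scalar_apply, ← Matrix.smul_eq_diagonal_mul]
  have h2 : (scalars (Matrix.GeneralLinearGroup.det g)⁻¹ * g).inv = g.val.det • g.inv := by
    change g.inv * Matrix.scalar (Fin 2) g.val.det = _
    rw [Matrix.scalar_apply, ← Matrix.smul_one_eq_diagonal, Matrix.mul_smul, mul_one]
  have h4 : (!![0, -1; 1, 0] * !![0, 1; -1, 0] : Matrix (Fin 2) (Fin 2) ℂ) = 1 := by
    simp [Matrix.one_fin_two]
  ext1
  change sMat * Matrix.fromBlocks g.val 0 0 g.inv.transpose =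
    Matrix.fromBlocks (scalars _ * g).val 0 0 (scalars _ * g).inv.transpose * sMat
  rw [h1, h2, sMat, Matrix.fromBlocks_multiply, Matrix.fromBlocks_multiply, Matrix.fromBlocks_inj,
    ← conj_inv_transpose]
  refine ⟨by simp, ?_, ?_, by simp⟩
  · rw [mul_assoc _ !![0, -1; 1, 0] !![0, 1; -1, 0], h4]
    simp
  · have h5 : g.val = g.val.det • (!![0, 1; -1, 0] * g.inv.transpose * !![0, -1; 1, 0]) := by
      rw [conj_inv_transpose, smul_smul, hd, one_smul]
    rw [zero_mul, add_zero, zero_add]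
    nth_rewrite 1 [h5]
    rw [Matrix.mul_smul, mul_assoc !![0, 1; -1, 0], ← mul_assoc !![0, -1; 1, 0], h4, one_mul,
      Matrix.transpose_smul, Matrix.smul_mul]

/-- If `G` contains the scalar matrices given by the determinants of its elements, then
`{g^∨, g^∨ s ∣ g ∈ G}` is a group. -/
theorem mem_E_iff {G : Subgroup (GL (Fin 2) ℂ)}
    (hG : ∀ g ∈ G, scalars (Matrix.GeneralLinearGroup.det g) ∈ G) {x : GL4} :
    x ∈ E G ↔ ∃ g ∈ G, x = vee g ∨ x = vee g * s := by
  refine ⟨fun hx => ?_, fun hx => Subgroup.subset_closure hx⟩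
  have hG' : ∀ g ∈ G, scalars (Matrix.GeneralLinearGroup.det g)⁻¹ * g ∈ G := fun g hg => by
    rw [map_inv]
    exact G.mul_mem (G.inv_mem (hG g hg)) hg
  induction hx using Subgroup.closure_induction with
  | mem x hx => exact hx
  | one => exact ⟨1, G.one_mem, Or.inl (map_one vee).symm⟩
  | mul x y _ _ hx hy =>
    obtain ⟨g, hg, rfl | rfl⟩ := hx <;> obtain ⟨h, hh, rfl | rfl⟩ := hy
    · exact ⟨g * h, G.mul_mem hg hh, Or.inl (map_mul vee g h).symm⟩
    · exact ⟨g * h, G.mul_mem hg hh, Or.inr (by rw [map_mul, mul_assoc])⟩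
    · exact ⟨_, G.mul_mem hg (hG' h hh), Or.inr (by
        rw [mul_assoc, s_mul_vee, ← mul_assoc, ← map_mul])⟩
    · exact ⟨_, G.mul_mem hg (hG' h hh), Or.inl (by
        rw [mul_assoc, ← mul_assoc s, s_mul_vee, mul_assoc _ s, s_mul_s, mul_one, ← map_mul])⟩
  | inv x _ hx =>
    obtain ⟨g, hg, rfl | rfl⟩ := hx
    · exact ⟨g⁻¹, G.inv_mem hg, Or.inl (map_inv vee g).symm⟩
    · exact ⟨_, hG' _ (G.inv_mem hg), Or.inr (by
        rw [mul_inv_rev, s_inv, ← map_inv, s_mul_vee])⟩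

theorem finite_E {G : Subgroup (GL (Fin 2) ℂ)} [Finite G]
    (hG : ∀ g ∈ G, scalars (Matrix.GeneralLinearGroup.det g) ∈ G) : Finite (E G) := by
  have h : (E G : Set GL4) ⊆ vee '' G ∪ (fun g => vee g * s) '' G := by
    intro x hx
    obtain ⟨g, hg, rfl | rfl⟩ := (mem_E_iff hG).1 hx
    · exact Or.inl ⟨g, hg, rfl⟩
    · exact Or.inr ⟨g, hg, rfl⟩
  have hf : (G : Set (GL (Fin 2) ℂ)).Finite := Set.toFinite _
  exact ((hf.image _).union (hf.image _)).subset h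

theorem mem_D {G : Subgroup (GL (Fin 2) ℂ)}
    (hG : ∀ z, (∀ g ∈ G, g * z = z * g) → z ∈ scalars.range) {x : GL4} (hx : x ∈ D G) :
    ∃ a, x = vee (scalars a) ∨ x = vee (scalars a) * s := by
  -- The group of all scalar matrices trivially contains the scalars given by its determinants, so
  -- `mem_E_iff` applies to it.
  have hle : D G ≤ E scalars.range := by
    rw [D, Subgroup.closure_le]
    rintro _ (⟨z, ⟨-, hz⟩, rfl⟩ | rfl)
    · exact Subgroup.subset_closure ⟨z, hG z hz, Or.inl rfl⟩
    · exact Subgroup.subset_closure ⟨1, one_mem _, Or.inr (by simp)⟩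
  obtain ⟨_, ⟨a, rfl⟩, h⟩ := (mem_E_iff fun g _ => MonoidHom.mem_range.2 ⟨_, rfl⟩).1 (hle hx)
  exact ⟨a, h⟩

/-! ### The symplectic reflections in `E(G)` -/

theorem mem_fixedSpace {n : Type} [Fintype n] [DecidableEq n] {g : GL n ℂ} {v : n → ℂ} :
    v ∈ fixedSpace g ↔ Matrix.mulVec g.val v = v := by
  rw [fixedSpace, LinearMap.mem_ker, LinearMap.sub_apply, sub_eq_zero]
  rfl

theorem fixedSpace_one {n : Type} [Fintype n] [DecidableEq n] :
    fixedSpace (1 : GL n ℂ) = ⊤ := by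
  ext v
  simp [mem_fixedSpace]

theorem eq_one_of_fixedSpace_eq_top {n : Type} [Fintype n] [DecidableEq n] {g : GL n ℂ}
    (h : fixedSpace g = ⊤) : g = 1 := by
  ext1
  refine Matrix.ext_of_mulVec_single fun i => ?_
  rw [mem_fixedSpace.1 (h ▸ Submodule.mem_top), Units.val_one, Matrix.one_mulVec]

/-- A vector fixed by `(gᵀ)⁻¹` is fixed by `gᵀ`, and `gᵀ - 1` has the same determinant as `g - 1`.
-/
theorem fixedSpace_vee_eq_bot {g : GL (Fin 2) ℂ} (h : fixedSpace g = ⊥) :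
    fixedSpace (vee g) = ⊥ := by
  have hdet : (g.val - 1).det ≠ 0 := by
    intro hd
    obtain ⟨v, hv, h0⟩ := Matrix.exists_mulVec_eq_zero_iff.2 hd
    rw [Matrix.sub_mulVec, Matrix.one_mulVec, sub_eq_zero, ← mem_fixedSpace, h] at h0
    exact hv h0
  rw [eq_bot_iff]
  intro x hx
  obtain ⟨a, b, rfl⟩ : ∃ a b, x = Sum.elim a b := ⟨_, _, (Sum.elim_comp_inl_inr x).symm⟩
  rw [mem_fixedSpace] at hx
  change Matrix.mulVec (Matrix.fromBlocks g.val 0 0 g.inv.transpose) _ = _ at hx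
  rw [Matrix.fromBlocks_mulVec] at hx
  obtain ⟨ha, hb⟩ := Sum.elim_eq_iff.1 hx
  simp only [Matrix.zero_mulVec, add_zero, zero_add, Sum.elim_comp_inl, Sum.elim_comp_inr]
    at ha hb
  have ha0 : a = 0 := by
    rw [← mem_fixedSpace, h] at ha
    exact ha
  have hb0 : b = 0 := by
    by_contra hb0
    refine hdet ?_
    rw [← Matrix.det_transpose, ← Matrix.exists_mulVec_eq_zero_iff]
    refine ⟨b, hb0, ?_⟩
    rw [Matrix.transpose_sub, Matrix.transpose_one, Matrix.sub_mulVec, Matrix.one_mulVec]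
    nth_rewrite 1 [← hb]
    rw [Matrix.mulVec_mulVec, ← Matrix.transpose_mul, g.inv_val, Matrix.transpose_one,
      Matrix.one_mulVec, sub_self]
  simp [ha0, hb0]

/-- The fixed space of `g` has dimension 0, 1 or 2; the extremes give `g^∨` a fixed space of
dimension 0 or 4 instead of 2. -/
theorem isReflection_of_isSympReflection_vee {g : GL (Fin 2) ℂ} (h : IsSympReflection (vee g)) :
    IsReflection g := by
  have h2 := Submodule.finrank_quotient_add_finrank (fixedSpace g)
  have h4 := Submodule.finrank_quotient_add_finrank (fixedSpace (vee g))
  rw [IsSympReflection] at h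
  rw [Module.finrank_fintype_fun_eq_card] at h2 h4
  simp only [Fintype.card_fin, Fintype.card_sum] at h2 h4
  have htop : fixedSpace g ≠ ⊤ := by
    intro ht
    rw [h, eq_one_of_fixedSpace_eq_top ht, map_one, fixedSpace_one, finrank_top,
      Module.finrank_fintype_fun_eq_card] at h4
    simp at h4
  have hbot : fixedSpace g ≠ ⊥ := by
    intro hb
    rw [h, fixedSpace_vee_eq_bot hb, finrank_bot] at h4
    omega
  have h1 : Module.finrank ℂ (fixedSpace g) ≠ 0 := fun h0 => hbot (Submodule.finrank_eq_zero.1 h0)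
  have h3 : Module.finrank ℂ (fixedSpace g) ≠ 2 := fun h0 =>
    htop (Submodule.eq_top_of_finrank_eq (by simp [h0]))
  rw [IsReflection]
  omega

theorem not_isSympReflection_vee_scalars (a : ℂˣ) : ¬ IsSympReflection (vee (scalars a)) := by
  intro h
  have h := isReflection_of_isSympReflection_vee h
  have h2 := Submodule.finrank_quotient_add_finrank (fixedSpace (scalars a))
  rw [IsReflection] at h
  rw [h, Module.finrank_fintype_fun_eq_card, Fintype.card_fin] at h2
  by_cases ha : a = 1
  · rw [ha, map_one, fixedSpace_one, finrank_top, Module.finrank_fintype_fun_eq_card,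
      Fintype.card_fin] at h2
    omega
  · have : fixedSpace (scalars a) = ⊥ := by
      rw [eq_bot_iff]
      intro v hv
      rw [mem_fixedSpace, scalars_val, Matrix.scalar_apply] at hv
      ext i
      have hi := congrFun hv i
      rw [Matrix.mulVec_diagonal] at hi
      by_contra h0
      exact ha (Units.ext (mul_right_cancel₀ h0 (hi.trans (one_mul _).symm)))
    rw [this, finrank_bot] at h2
    omega

/-- A fixed vector of `g^∨ s` is determined by its first half. If the fixed space has dimension two,
every first half occurs, and eliminating the second half gives `g² = det(g) · 1`. Together with
Cayley–Hamilton this makes `tr(g) g` scalar, with `tr(g) ≠ 0`. -/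
theorem mem_range_scalars_of_isSympReflection {g : GL (Fin 2) ℂ}
    (h : IsSympReflection (vee g * s)) : g ∈ scalars.range := by
  have h4 := Submodule.finrank_quotient_add_finrank (fixedSpace (vee g * s))
  rw [IsSympReflection] at h
  rw [h, Module.finrank_fintype_fun_eq_card] at h4
  simp only [Fintype.card_fin, Fintype.card_sum] at h4
  have hfix : ∀ x : V, x ∈ fixedSpace (vee g * s) →
      Matrix.mulVec (g.val * !![0, 1; -1, 0]) (x ∘ Sum.inr) = x ∘ Sum.inl ∧
      Matrix.mulVec (g.inv.transpose * !![0, -1; 1, 0]) (x ∘ Sum.inl) = x ∘ Sum.inr := by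
    intro x hx
    rw [mem_fixedSpace] at hx
    change Matrix.mulVec (Matrix.fromBlocks g.val 0 0 g.inv.transpose * sMat) _ = _ at hx
    rw [sMat, Matrix.fromBlocks_multiply, Matrix.fromBlocks_mulVec] at hx
    replace hx := hx.trans (Sum.elim_comp_inl_inr x).symm
    obtain ⟨ha, hb⟩ := Sum.elim_eq_iff.1 hx
    simp only [mul_zero, zero_mul, Matrix.zero_mulVec, add_zero, zero_add] at ha hb
    exact ⟨ha, hb⟩
  let p : fixedSpace (vee g * s) →ₗ[ℂ] (Fin 2 → ℂ) :=
    (LinearMap.funLeft ℂ ℂ Sum.inl).comp (fixedSpace (vee g * s)).subtype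
  have hp : Function.Injective p := by
    rw [injective_iff_map_eq_zero]
    rintro ⟨x, hx⟩ h0
    have hl : x ∘ Sum.inl = 0 := h0
    have hr : x ∘ Sum.inr = 0 := by rw [← (hfix x hx).2, hl, Matrix.mulVec_zero]
    ext i
    rcases i with i | i
    · exact congrFun hl i
    · exact congrFun hr i
  have hs : Function.Surjective p :=
    (LinearMap.injective_iff_surjective_of_finrank_eq_finrank (by simp; omega)).1 hp
  have hsq : g.inv.det • (g.val * g.val) = 1 := by
    rw [← Matrix.mul_smul, ← conj_inv_transpose]
    refine Matrix.ext_of_mulVec_single fun i => ?_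
    obtain ⟨⟨x, hx⟩, hxi⟩ := hs (Pi.single i 1)
    have hl : x ∘ Sum.inl = Pi.single i 1 := hxi
    rw [← hl, Matrix.one_mulVec]
    nth_rewrite 2 [← (hfix x hx).1]
    rw [← (hfix x hx).2, Matrix.mulVec_mulVec]
    simp only [mul_assoc]
  have hdet : g.val.det * g.inv.det = 1 := by rw [← Matrix.det_mul, g.val_inv, Matrix.det_one]
  have hsq' : g.val * g.val = g.val.det • 1 := by
    rw [← hsq, smul_smul, hdet, one_smul]
  have hd : g.val.det ≠ 0 := left_ne_zero_of_mul_eq_one hdet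
  rw [Matrix.det_fin_two] at hsq' hd
  rw [← Matrix.ext_iff] at hsq'
  simp only [Fin.forall_fin_two, Matrix.mul_apply, Fin.sum_univ_two, Matrix.smul_apply,
    Matrix.one_apply_eq, smul_eq_mul, mul_one, ne_eq, zero_ne_one, one_ne_zero,
    not_false_eq_true, Matrix.one_apply_ne, mul_zero] at hsq'
  obtain ⟨⟨h1, h2⟩, h3, h5⟩ := hsq'
  -- With trace zero one would have `g² = -det(g) · 1`, so `det g = 0`.
  have htr : g.val 0 0 + g.val 1 1 ≠ 0 := by
    intro htr
    apply hd
    grind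
  have hq : g.val 0 1 = 0 := by
    apply mul_left_cancel₀ htr
    grind
  have hr : g.val 1 0 = 0 := by
    apply mul_left_cancel₀ htr
    grind
  refine mem_range_scalars hq hr ?_
  grind

/-! ### The groups in the four families -/

theorem IsBinaryPolyhedral.neg_one_mem {n : ℕ} {Γ : Subgroup (GL (Fin 2) ℂ)}
    (h : IsBinaryPolyhedral n Γ) : -1 ∈ Γ := by
  obtain ⟨-, -, r, s, t, hr, -, -, -, rfl⟩ := h
  rw [← hr]
  exact Subgroup.pow_mem _ (Subgroup.subset_closure (by simp)) 2

/-- Binary tetrahedral, octahedral and icosahedral groups are not commutative. -/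
theorem IsBinaryPolyhedral.exists_not_commute {n : ℕ} (hn : n = 3 ∨ n = 4 ∨ n = 5)
    {Γ : Subgroup (GL (Fin 2) ℂ)} (h : IsBinaryPolyhedral n Γ) :
    ∃ a ∈ Γ, ∃ b ∈ Γ, a * b ≠ b * a := by
  obtain ⟨-, -, r, s, t, hr, hs, ht, hrst, rfl⟩ := h
  by_contra! hc
  have hrm : r ∈ Subgroup.closure {r, s, t} := Subgroup.subset_closure (by simp)
  have hsm : s ∈ Subgroup.closure {r, s, t} := Subgroup.subset_closure (by simp)
  have htm : t ∈ Subgroup.closure {r, s, t} := Subgroup.subset_closure (by simp)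
  -- If the generators commute, `r s t = -1` can be raised to powers factorwise. The exponents used
  -- below, 6, 12 and 30, are `lcm(2, 3, n)`: the left side is `1`, while exactly one factor on the
  -- right is `-1`.
  have hpow : ∀ k, (-1 : GL (Fin 2) ℂ) ^ k = r ^ k * s ^ k * t ^ k := by
    intro k
    rw [← hrst, (show Commute (r * s) t from hc _ (mul_mem hrm hsm) _ htm).mul_pow,
      (show Commute r s from hc _ hrm _ hsm).mul_pow]
  have hne : (-1 : GL (Fin 2) ℂ) ≠ 1 := by
    intro h
    have h1 : (-1 : Matrix (Fin 2) (Fin 2) ℂ) 0 0 = (1 : Matrix (Fin 2) (Fin 2) ℂ) 0 0 :=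
      Matrix.ext_iff.2 (congrArg (fun g : GL (Fin 2) ℂ => g.val) h) 0 0
    rw [Matrix.neg_apply, Matrix.one_apply_eq] at h1
    norm_num at h1
  rcases hn with rfl | rfl | rfl
  · have h := hpow 6
    rw [show r ^ 6 = (r ^ 2) ^ 3 from pow_mul r 2 3, show s ^ 6 = (s ^ 3) ^ 2 from pow_mul s 3 2,
      show t ^ 6 = (t ^ 3) ^ 2 from pow_mul t 3 2, hr, hs, ht] at h
    exact hne (by simpa [Even.neg_pow (by decide : Even 6), Odd.neg_pow (by decide : Odd 3)]
      using h.symm)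
  · have h := hpow 12
    rw [show r ^ 12 = (r ^ 2) ^ 6 from pow_mul r 2 6,
      show s ^ 12 = (s ^ 3) ^ 4 from pow_mul s 3 4,
      show t ^ 12 = (t ^ 4) ^ 3 from pow_mul t 4 3, hr, hs, ht] at h
    exact hne (by simpa [Even.neg_pow (by decide : Even 12), Even.neg_pow (by decide : Even 6),
      Even.neg_pow (by decide : Even 4), Odd.neg_pow (by decide : Odd 3)] using h.symm)
  · have h := hpow 30
    rw [show r ^ 30 = (r ^ 2) ^ 15 from pow_mul r 2 15,
      show s ^ 30 = (s ^ 3) ^ 10 from pow_mul s 3 10,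
      show t ^ 30 = (t ^ 5) ^ 6 from pow_mul t 5 6, hr, hs, ht] at h
    exact hne (by simpa [Even.neg_pow (by decide : Even 30), Even.neg_pow (by decide : Even 10),
      Even.neg_pow (by decide : Even 6), Odd.neg_pow (by decide : Odd 15)] using h.symm)

theorem IsBinaryPolyhedral.det_eq_one {n : ℕ} {Γ : Subgroup (GL (Fin 2) ℂ)}
    (h : IsBinaryPolyhedral n Γ) {g : GL (Fin 2) ℂ} (hg : g ∈ Γ) :
    Matrix.GeneralLinearGroup.det g = 1 :=
  Units.ext (h.2.1 g hg)

theorem scalars_mem_mu {d : ℕ} {a : ℂˣ} (ha : a ^ d = 1) : scalars a ∈ mu d :=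
  ⟨a, (mem_rootsOfUnity d a).2 ha, rfl⟩

theorem det_scalars (a : ℂˣ) : Matrix.GeneralLinearGroup.det (scalars a) = a ^ 2 := by
  simp [scalars]

instance mu_normal (d : ℕ) : (mu d).Normal where
  conj_mem := by
    rintro _ ⟨a, ha, rfl⟩ g
    refine ⟨a, ha, ?_⟩
    rw [← scalars_mul_comm, mul_inv_cancel_right]

/-- As `μ_d` is normal, the join is a product of two finite sets. -/
theorem finite_mu_sup {d : ℕ} (hd : 0 < d) (Γ : Subgroup (GL (Fin 2) ℂ)) [Finite Γ] :
    Finite (mu d ⊔ Γ : Subgroup (GL (Fin 2) ℂ)) := by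
  have : NeZero d := ⟨hd.ne'⟩
  have hmu : (mu d : Set (GL (Fin 2) ℂ)).Finite :=
    Set.Finite.image _ (show Finite (rootsOfUnity d ℂ) from inferInstance)
  have h : ((mu d ⊔ Γ : Subgroup (GL (Fin 2) ℂ)) : Set (GL (Fin 2) ℂ)).Finite := by
    rw [Subgroup.normal_mul]
    exact hmu.mul (Set.toFinite _)
  exact h

/-- The determinant is `1` on `Γ` and squares the scalars of `μ_d`. -/
theorem scalars_det_mem_mu_sup {n d : ℕ} {Γ : Subgroup (GL (Fin 2) ℂ)}
    (h : IsBinaryPolyhedral n Γ) :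
    ∀ g ∈ mu d ⊔ Γ, scalars (Matrix.GeneralLinearGroup.det g) ∈ mu d ⊔ Γ := by
  suffices mu d ⊔ Γ ≤ (mu d ⊔ Γ).comap (scalars.comp Matrix.GeneralLinearGroup.det) from
    fun g hg => this hg
  refine sup_le ?_ fun g hg => ?_
  · rintro _ ⟨a, ha, rfl⟩
    refine Subgroup.mem_sup_left ?_
    change scalars (Matrix.GeneralLinearGroup.det (scalars a)) ∈ mu d
    rw [det_scalars, map_pow]
    exact pow_mem (Subgroup.mem_map_of_mem _ ha) 2
  · change scalars (Matrix.GeneralLinearGroup.det g) ∈ mu d ⊔ Γ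
    rw [h.det_eq_one hg, map_one]
    exact one_mem _

/-- What is needed about the groups in the four families. -/
structure IsAdmissible (G : Subgroup (GL (Fin 2) ℂ)) : Prop where
  finite : Finite G
  neg_one_mem : -1 ∈ G
  exists_not_commute : ∃ a ∈ G, ∃ b ∈ G, a * b ≠ b * a
  scalars_det_mem : ∀ g ∈ G, scalars (Matrix.GeneralLinearGroup.det g) ∈ G

theorem isAdmissible_mu_sup {n d : ℕ} (hn : n = 3 ∨ n = 4 ∨ n = 5) (hd : 0 < d)
    {Γ : Subgroup (GL (Fin 2) ℂ)} (h : IsBinaryPolyhedral n Γ) : IsAdmissible (mu d ⊔ Γ) where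
  finite := have := h.1; finite_mu_sup hd Γ
  neg_one_mem := Subgroup.mem_sup_right h.neg_one_mem
  exists_not_commute := by
    obtain ⟨a, ha, b, hb, hab⟩ := h.exists_not_commute hn
    exact ⟨a, Subgroup.mem_sup_right ha, b, Subgroup.mem_sup_right hb, hab⟩
  scalars_det_mem := scalars_det_mem_mu_sup h

/-- The group lies in the finite group `μ_{2d} O` and contains `T`, the part with `k = 0`. The
determinants of its elements are `ζ^{2k}`, whose even exponent puts the corresponding scalars in the
group. -/
theorem IsOT.isAdmissible {d : ℕ} (hd : 0 < d) {G : Subgroup (GL (Fin 2) ℂ)} (h : IsOT d G) :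
    IsAdmissible G := by
  obtain ⟨T, O, hT, hO, hTO, w, hw, -, ζ, hζ, hG⟩ := h
  have hTG : T ≤ G := fun t ht => (hG t).2 ⟨0, t, ht, Or.inl ⟨Even.zero, by simp⟩⟩
  have hle : G ≤ mu (2 * d) ⊔ O := by
    intro x hx
    have hζk : ∀ k : ℕ, scalars (ζ ^ k) ∈ mu (2 * d) ⊔ O := fun k =>
      Subgroup.mem_sup_left (scalars_mem_mu (by rw [← pow_mul, mul_comm, pow_mul, hζ.pow_eq_one,
        one_pow]))
    obtain ⟨k, t, ht, ⟨-, rfl⟩ | ⟨-, rfl⟩⟩ := (hG x).1 hx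
    · exact mul_mem (hζk k) (Subgroup.mem_sup_right (hTO ht))
    · exact mul_mem (mul_mem (hζk k) (Subgroup.mem_sup_right hw)) (Subgroup.mem_sup_right (hTO ht))
  have hfin : Finite (mu (2 * d) ⊔ O : Subgroup (GL (Fin 2) ℂ)) :=
    have := hO.1; finite_mu_sup (by omega) O
  refine ⟨Finite.of_injective _ (Subgroup.inclusion_injective hle), hTG hT.neg_one_mem, ?_, ?_⟩
  · obtain ⟨a, ha, b, hb, hab⟩ := IsBinaryPolyhedral.exists_not_commute (Or.inl rfl) hT
    exact ⟨a, hTG ha, b, hTG hb, hab⟩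
  · intro x hx
    have hζk : ∀ k : ℕ, scalars ((ζ ^ k) ^ 2) ∈ G := fun k =>
      (hG _).2 ⟨k * 2, 1, T.one_mem, Or.inl ⟨even_two.mul_left k, by rw [mul_one, pow_mul]⟩⟩
    obtain ⟨k, t, ht, ⟨-, rfl⟩ | ⟨-, rfl⟩⟩ := (hG x).1 hx
    · rw [map_mul Matrix.GeneralLinearGroup.det, det_scalars, IsBinaryPolyhedral.det_eq_one hT ht, mul_one]
      exact hζk k
    · rw [map_mul Matrix.GeneralLinearGroup.det, map_mul Matrix.GeneralLinearGroup.det, det_scalars,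
        IsBinaryPolyhedral.det_eq_one hT ht, IsBinaryPolyhedral.det_eq_one hO hw, mul_one, mul_one]
      exact hζk k

theorem IsListed.isAdmissible {G : Subgroup (GL (Fin 2) ℂ)} (h : IsListed G) :
    IsAdmissible G := by
  obtain ⟨d, hd, ⟨-, T, hT, rfl⟩ | ⟨-, O, hO, rfl⟩ | ⟨-, I, hI, rfl⟩ | ⟨-, h⟩⟩ := h
  · exact isAdmissible_mu_sup (by simp) hd hT
  · exact isAdmissible_mu_sup (by simp) hd hO
  · exact isAdmissible_mu_sup (by simp) hd hI
  · exact h.isAdmissible (by omega)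

/-! ### Distribution of the symplectic reflections between `G₀^∨` and `D` -/

namespace IsAdmissible

variable {G : Subgroup (GL (Fin 2) ℂ)}

theorem finite_E (hG : IsAdmissible G) : Finite (E G) :=
  have := hG.finite; SympRefl.finite_E hG.scalars_det_mem

theorem finite_D (hG : IsAdmissible G) : Finite (D G) :=
  have := hG.finite_E; Finite.of_injective _ (Subgroup.inclusion_injective (D_le_E G))

theorem neg_one_mem_D (hG : IsAdmissible G) : -1 ∈ D G := by
  rw [← vee_neg_one]
  exact Subgroup.subset_closure (Or.inl ⟨-1, ⟨hG.neg_one_mem, fun g _ => by simp⟩, rfl⟩)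

theorem mem_range_scalars_of_central (hG : IsAdmissible G) {z : GL (Fin 2) ℂ}
    (hz : ∀ g ∈ G, g * z = z * g) :
    z ∈ scalars.range := by
  obtain ⟨a, ha, b, hb, hab⟩ := hG.exists_not_commute
  exact mem_range_scalars_of_commute hab (hz a ha) (hz b hb)

/-- Every symplectic reflection in `E(G)` lies in exactly one of `G₀^∨` and `D`. -/
theorem xor_mem_of_isSympReflection (hG : IsAdmissible G) {x : GL4} (hx : x ∈ E G)
    (hr : IsSympReflection x) :
    (x ∈ (G₀ G).map vee ∧ x ∉ D G) ∨ (x ∉ (G₀ G).map vee ∧ x ∈ D G) := by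
  obtain ⟨g, hg, rfl | rfl⟩ := (mem_E_iff hG.scalars_det_mem).1 hx
  · left
    refine ⟨⟨g, Subgroup.subset_closure ⟨hg, isReflection_of_isSympReflection_vee hr⟩, rfl⟩, ?_⟩
    intro hD
    obtain ⟨a, ha | ha⟩ := mem_D (fun z hz => hG.mem_range_scalars_of_central hz) hD
    · exact not_isSympReflection_vee_scalars a (ha ▸ hr)
    · exact vee_ne_vee_mul_s _ _ ha
  · right
    constructor
    · rintro ⟨h, -, hh⟩
      exact vee_ne_vee_mul_s _ _ hh
    -- Here `g` is scalar, hence central in `G`, so both factors of `g^∨ s` are generators of `D`.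
    · obtain ⟨a, rfl⟩ := mem_range_scalars_of_isSympReflection hr
      refine mul_mem (Subgroup.subset_closure (Or.inl ⟨_, ⟨hg, fun h _ => ?_⟩, rfl⟩))
        (Subgroup.subset_closure (Or.inr rfl))
      exact (scalars_mul_comm a h).symm

/-- Membership in exactly one of the two subgroups makes exactly one summand equal to `c x` and the
other zero. -/
theorem eq_c₁_add_c₂ (hG : IsAdmissible G) (c : GL4 → ℂ) {x : GL4} (hx : x ∈ E G)
    (hr : IsSympReflection x) :
    c x = c₁ G c x + c₂ G c x := by
  rcases hG.xor_mem_of_isSympReflection hx hr with ⟨h₁, h₂⟩ | ⟨h₁, h₂⟩ <;>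
    simp [c₁, c₂, h₁, h₂]

end IsAdmissible

/-! ### The criterion for arbitrary modules and for `R(L)` -/

/-- A module over `H_{c₁}(E(G))` is one over `H_c(E(G))` if and only if the constituents of its
restriction to `D` are `c₂`-rigid. -/
theorem IsAdmissible.isModuleFor_iff {G : Subgroup (GL (Fin 2) ℂ)} (hG : IsAdmissible G)
    (c : GL4 → ℂ) (M : Type*) [AddCommGroup M] [Module (H (c₁ G c) (E G)) M] :
    IsModuleFor (c' := c₁ G c) (Γ := E G) c M ↔
      AllConstituentsRigid (c₂ G c) (D G) (Res (A := MonoidAlgebra ℂ (D G))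
        (B := H (c₁ G c) (E G)) (groupAlgebraToH (c₁ G c) (D_le_E G)).toRingHom M) := by
  have := hG.finite_E
  have := hG.finite_D
  rw [SympRefl.isModuleFor_iff, allConstituentsRigid_iff _ _ hG.neg_one_mem_D]
  refine forall_congr' fun u => forall_congr' fun v => forall_congr' fun m => ?_
  have h₁ : reflSum c (E G) u v = reflSum (c₁ G c) (E G) u v + reflSum (c₂ G c) (E G) u v :=
    reflSum_add (E G) (fun g hg hr => hG.eq_c₁_add_c₂ c hg hr) u v
  have h₂ : groupAlgebraToH (c₁ G c) (D_le_E G) (groupReflSum (c₂ G c) (D G) u v) =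
      toH (c₁ G c) (E G) (reflSum (c₂ G c) (E G) u v) := by
    rw [groupAlgebraToH_apply, groupAlgebraToSkew_groupReflSum, skewIncl_reflSum]
    intro g _ hg
    exact if_neg hg
  -- Cancelling the `c₁`-sum leaves the vanishing of the `c₂`-sum, which comes from `ℂ[D]`.
  rw [h₁, map_add, add_smul, left_eq_add, ← h₂]
  rfl

end SympRefl

end

theorem mainTheorem6 (G : Subgroup (Matrix.GeneralLinearGroup (Fin 2) ℂ))
    (hG : SympRefl.IsListed G)
    (c : SympRefl.GL4 → ℂ) (hc : SympRefl.IsParameter c (SympRefl.E G))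
    (L : Type*) [AddCommGroup L]
    [Module (SympRefl.H (SympRefl.c₁ G c) (SympRefl.Gvee G)) L]
    [IsSimpleModule (SympRefl.H (SympRefl.c₁ G c) (SympRefl.Gvee G)) L] :
    SympRefl.IsModuleFor (c' := SympRefl.c₁ G c) (Γ := SympRefl.E G) c (SympRefl.R G c L) ↔
      SympRefl.AllConstituentsRigid (SympRefl.c₂ G c) (SympRefl.D G)
        (SympRefl.RestrictedR G c L) :=
  hG.isAdmissible.isModuleFor_iff c (SympRefl.R G c L)
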